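/- Let $\mathbb{N}=\{1,2,3,\dots\}$, $e(x)=e^{2\pi i x}$, let $\lfloor x\rfloor$ and $\{x\}=x-\lfloor x\rfloor$ be the integer and fractional parts of $x\in\mathbb{R}$ (with $\lfloor\cdot\rfloor$ taken coordinatewise on $\mathbb{R}^\ell$), and let $\pi(N)$ be the number of primes $p\le N$. A $k$-step nilsequence is a sequence $\psi(n)=F(g^n x)$, $n\in\mathbb{N}$, where $G$ is a $k$-step nilpotent (that is, nilpotent of class at most $k$) Lie group, $\Gamma$ is a discrete co-compact subgroup of $G$, $F:G/\Gamma\to\mathbb{C}$ is continuous, $g\in G$ and $x\in G/\Gamma$. A sequence $\phi:\mathbb{N}\to\mathbb{C}$ is a uniform limit of $k$-step nilsequences if for every $\epsilon>0$ there is a $k$-step nilsequence $\psi$ with $\sup_{n\in\mathbb{N}}|\phi(n)-\psi(n)|\le\epsilon$; it is a uniform limit of nilsequences if for every $\epsilon>0$ there are some $k$ (possibly depending on $\epsilon$) and a $k$-step nilsequence $\psi$ with this property. For $\ell,m,d\in\mathbb{N}$, let $\mathcal{M}(\ell,m,d)$ be the set of all sequences $$\alpha(n)=\int_X f_0\cdot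 T^{\lfloor q_1(n)\rfloor}f_1\cdots T^{\lfloor q_m(n)\rfloor}f_m\,d\mu ,$$ where $T$ is a measure preserving $\mathbb{Z}^\ell$-action on a probability space $(X,\mathcal{B},\mu)$, $T^{v}f=f\circ T^{v}$, $q_1,\dots,q_m:\mathbb{R}\to\mathbb{R}^\ell$ are polynomials of degree at most $d$, and $f_0,\dots,f_m\in L^\infty(X)$. On $X=\mathbb{R}/\mathbb{Z}$ with Lebesgue measure, take $T(x)=x+1/\sqrt2$, $q(n)=\sqrt2\,n$, $f_0(x)=e(x)$, $f_1(x)=e(-x)$, and let $\alpha(n)=\int f_0\cdot T^{\lfloor q(n)\rfloor}f_1\,d\mu$. Then: 1. $\alpha\in\mathcal{M}(1,1,1)$, and $\alpha(n)=e\big(\{\sqrt2\,n\}/\sqrt2\big)$ for every $n$. 2. There is no uniform limit of nilsequences $\phi$ with $$\lim_{N\to\infty}\frac1N\sum_{n=1}^N|\alpha(n)-\phi(n)|=0 ;$$ in particular there is no uniform limit of nilsequences $\phi$ such that $\alpha(n)=\phi(n)$ for all $n$ outside a set of zero natural density. 3. Consequently, for no $k$ is it true that for every $\alpha\in\mathcal{M}(1,1,1)$,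 $r\in\mathbb{N}$ and $s\in\mathbb{Z}$ there is a uniform limit $\phi$ of $k$-step nilsequences with both $$\lim_{N-M\to\infty}\frac1{N-M}\sum_{n=M}^{N-1}|\alpha(n)-\phi(n)|=0\quad\text{and}\quad \lim_{N\to\infty}\frac1{\pi(N)}\sum_{p\le N,\ p\text{ prime}}|\alpha(rp+s)-\phi(rp+s)|=0 .$$ That is, in the theorem that for all $\ell,m,d$ there is $k$ such that for every $\epsilon>0$ every $\alpha\in\mathcal{M}(\ell,m,d)$ is approximated in both of these senses, with error at most $\epsilon$, by a $k$-step nilsequence, one cannot replace $\epsilon$ by $0$ (even after replacing nilsequences by uniform limits of nilsequences). -/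

import Mathlib

open Filter Topology MeasureTheory
open scoped Manifold ContDiff

universe u

/-! ### Nilsequences -/

/-- `ψ` is a `k`-step nilsequence: `ψ n = F (gⁿ x)`, where `F` is a continuous function on a
`k`-step nilmanifold `G / Γ` (`G` a nilpotent Lie group, of finite dimension and of nilpotency
class at most `k`, and `Γ` a discrete co-compact subgroup), `g ∈ G` and `x ∈ G / Γ`. -/
def IsKStepNilsequence (k : ℕ) (ψ : ℕ → ℂ) : Prop :=
  ∃ (D : ℕ) (G : Type u) (_ : Group G) (_ : TopologicalSpace G)
    (_ : ChartedSpace (EuclideanSpace ℝ (Fin D)) G),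
    LieGroup (𝓡 D) ∞ G ∧ T2Space G ∧
    Group.IsNilpotent G ∧ Group.nilpotencyClass G ≤ k ∧
    ∃ Γ : Subgroup G, DiscreteTopology Γ ∧ CompactSpace (G ⧸ Γ) ∧
      ∃ (F : G ⧸ Γ → ℂ) (g : G) (x : G ⧸ Γ), Continuous F ∧ ∀ n : ℕ, ψ n = F (g ^ n • x)

/-- `φ` is a uniform limit of `k`-step nilsequences. The index set is `{1, 2, 3, …}`; the value
`φ 0` plays no role. -/
def IsUniformLimitOfKStepNilsequences (k : ℕ) (φ : ℕ → ℂ) : Prop :=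
  ∀ ε : ℝ, 0 < ε → ∃ ψ : ℕ → ℂ, IsKStepNilsequence.{u} k ψ ∧ ∀ n : ℕ, 1 ≤ n → ‖φ n - ψ n‖ ≤ ε

/-- `φ` is a uniform limit of nilsequences (whose steps may be unbounded). -/
def IsUniformLimitOfNilsequences (φ : ℕ → ℂ) : Prop :=
  ∀ ε : ℝ, 0 < ε →
    ∃ (k : ℕ) (ψ : ℕ → ℂ), IsKStepNilsequence.{u} k ψ ∧ ∀ n : ℕ, 1 ≤ n → ‖φ n - ψ n‖ ≤ ε

/-! ### Modes of agreement of two sequences -/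

/-- `lim_{N → ∞} (1 / N) ∑_{n = 1}^{N} |α n - φ n| = 0`. -/
def CesaroAgree (α φ : ℕ → ℂ) : Prop :=
  Tendsto (fun N : ℕ => (∑ n ∈ Finset.Icc 1 N, ‖α n - φ n‖) / (N : ℝ)) atTop (𝓝 0)

/-- `α n = φ n` for all `n ≥ 1` outside a set of natural density zero. -/
def EqualOffDensityZero (α φ : ℕ → ℂ) : Prop :=
  Tendsto (fun N : ℕ => (Set.ncard {n : ℕ | 1 ≤ n ∧ n ≤ N ∧ α n ≠ φ n} : ℝ) / (N : ℝ))
    atTop (𝓝 0)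

/-- `lim_{N - M → ∞} (1 / (N - M)) ∑_{n = M}^{N - 1} |α n - φ n| = 0`. -/
def UniformCesaroAgree (α φ : ℕ → ℂ) : Prop :=
  ∀ ε : ℝ, 0 < ε → ∃ L : ℕ, ∀ M N : ℕ, 1 ≤ M → M + L ≤ N →
    (∑ n ∈ Finset.Ico M N, ‖α n - φ n‖) / ((N : ℝ) - (M : ℝ)) ≤ ε

/-- `lim_{N → ∞} (1 / π(N)) ∑_{p ≤ N prime} |α (r p + s) - φ (r p + s)| = 0`. For `r ≥ 1` only
finitely many `p` have `r p + s ≤ 0`; they do not affect the limit. -/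
def PrimeCesaroAgree (r : ℕ) (s : ℤ) (α φ : ℕ → ℂ) : Prop :=
  Tendsto (fun N : ℕ =>
    (∑ p ∈ (Finset.Icc 1 N).filter Nat.Prime,
      ‖α ((r : ℤ) * (p : ℤ) + s).toNat - φ ((r : ℤ) * (p : ℤ) + s).toNat‖) /
        (Nat.primeCounting N : ℝ)) atTop (𝓝 0)

/-! ### Multicorrelation sequences with integer part polynomial iterates -/

/-- `T` is a measure preserving action of `ℤ^ℓ` on `(X, μ)`. -/
structure IsMeasurePreservingAction {ℓ : ℕ} {X : Type*} [MeasurableSpace X] (μ : Measure X)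
    (T : (Fin ℓ → ℤ) → X → X) : Prop where
  zero_act : ∀ x, T 0 x = x
  add_act : ∀ v w x, T (v + w) x = T v (T w x)
  measurePreserving : ∀ v, MeasurePreserving (T v) μ μ

/-- `α n = ∫ f₀ · T^{⌊q₁(n)⌋} f₁ ⋯ T^{⌊q_m(n)⌋} f_m dμ` for some measure preserving `ℤ^ℓ`-action
`T` on a probability space, some `f₀, …, f_m ∈ L^∞` and some polynomials
`q₁, …, q_m : ℝ → ℝ^ℓ` of degree at most `d`. -/
def IsMulticorrelationSequence (ℓ m d : ℕ) (α : ℕ → ℂ) : Prop :=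
  ∃ (X : Type) (_ : MeasurableSpace X) (μ : Measure X) (T : (Fin ℓ → ℤ) → X → X)
    (q : Fin m → Fin ℓ → Polynomial ℝ) (f₀ : X → ℂ) (f : Fin m → X → ℂ),
    IsProbabilityMeasure μ ∧ IsMeasurePreservingAction μ T ∧
    (∀ i j, (q i j).natDegree ≤ d) ∧
    MemLp f₀ ⊤ μ ∧ (∀ i, MemLp (f i) ⊤ μ) ∧
    ∀ n : ℕ, α n = ∫ x, f₀ x * ∏ i, f i (T (fun j => ⌊(q i j).eval (n : ℝ)⌋) x) ∂μ

/-- For the given `ℓ, m, d, k`: every multicorrelation sequence with these parameters is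
approximated with error exactly zero, in uniform Cesàro mean and in mean along each `r p + s`
(`p` prime), by a uniform limit of `k`-step nilsequences. -/
def ZeroErrorApproximation (ℓ m d k : ℕ) : Prop :=
  ∀ α : ℕ → ℂ, IsMulticorrelationSequence ℓ m d α → ∀ (r : ℕ) (s : ℤ), 1 ≤ r →
    ∃ φ : ℕ → ℂ, IsUniformLimitOfKStepNilsequences.{u} k φ ∧
      UniformCesaroAgree α φ ∧ PrimeCesaroAgree r s α φ

/-! ### The example on the circle `ℝ / ℤ` -/

/-- `e(x) = exp (2 π i x)` on `ℝ / ℤ`. -/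
noncomputable def circleExp (x : UnitAddCircle) : ℂ := (AddCircle.toCircle x : ℂ)

/-- The rotation `T x = x + 1 / √2` of `ℝ / ℤ`. -/
noncomputable def rotationT : Equiv.Perm UnitAddCircle :=
  Equiv.addRight ((1 / Real.sqrt 2 : ℝ) : UnitAddCircle)

/-- `α n = ∫ e(x) · e(-T^{⌊√2 n⌋} x) dx`, the integral taken over `ℝ / ℤ`. -/
noncomputable def exampleAlpha (n : ℕ) : ℂ :=
  ∫ x : UnitAddCircle, circleExp x * circleExp (-((rotationT ^ ⌊Real.sqrt 2 * (n : ℝ)⌋) x))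

/-! ### Translations on quotients of nilpotent topological groups -/

section Nilpotent

variable {G : Type u} [Group G] [TopologicalSpace G] [IsTopologicalGroup G]

/-! A nilsequence `F (g ^ n • x)` converges to `F x` along every idempotent ultrafilter, whichever
one is chosen, because translations of compact nilmanifolds are distal. Uniform limits inherit this
independence up to ε. The sequence `α n = e({√2 n}/√2)` violates it: it tends to `1` when `{√2 n} →
0⁺` and to `e(1/√2) ≠ 1` when `{√2 n} → 1⁻`. Both regimes are realised by idempotent ultrafilters
that refine the density filter, so discrepancies on sets of density zero cannot repair the mismatch.

Recurrence (`tendsto_pow_smul_of_idempotent`) is lifted down a tower of closed subgroups from `G` to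
`Γ`, each normalizing the next. The ultrafilters come from the Ellis–Numakura lemma applied to
`returnFilter`, which is proper because an irrational rotation visits each arc with bounded gaps. -/

theorem t2Space_quotient_of_isClosed {H : Subgroup G} (hH : IsClosed (H : Set G)) :
    T2Space (G ⧸ H) := by
  rw [t2Space_iff_of_isOpenQuotientMap (QuotientGroup.isOpenQuotientMap_mk (N := H))]
  have : {q : G × G | (q.1 : G ⧸ H) = (q.2 : G ⧸ H)} =
      (fun q : G × G => q.1⁻¹ * q.2) ⁻¹' (H : Set G) := by
    ext q
    simp [QuotientGroup.eq]
  rw [this]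
  exact hH.preimage (by fun_prop)

/-- Right translation of `G ⧸ H` by an element `h` normalizing `H`. -/
def quotientRightMul (H : Subgroup G) (h : G) (hh : ∀ x ∈ H, h⁻¹ * x * h ∈ H) : G ⧸ H → G ⧸ H :=
  Quotient.lift (fun a : G => ((a * h : G) : G ⧸ H)) fun a b hab => by
    rw [QuotientGroup.eq]
    have := hh _ (QuotientGroup.leftRel_apply.1 hab)
    simpa [mul_assoc] using this

theorem continuous_quotientRightMul (H : Subgroup G) (h : G) (hh : ∀ x ∈ H, h⁻¹ * x * h ∈ H) :
    Continuous (quotientRightMul H h hh) :=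
  Continuous.quotient_lift
    (QuotientGroup.continuous_mk.comp (continuous_id.mul continuous_const)) _

omit [TopologicalSpace G] [IsTopologicalGroup G] in
theorem quotientRightMul_smul (H : Subgroup G) (h : G) (hh : ∀ x ∈ H, h⁻¹ * x * h ∈ H)
    (g : G) (x : G ⧸ H) : quotientRightMul H h hh (g • x) = g • quotientRightMul H h hh x := by
  induction x using QuotientGroup.induction_on with
  | H a => exact congrArg (QuotientGroup.mk (s := H)) (mul_assoc g a h)

/-- An ultrafilter on `ℕ` which is idempotent for addition of ultrafilters. -/
def IsIdempotentUltrafilter (p : Ultrafilter ℕ) : Prop :=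
  ∀ s ∈ p, ∀ᶠ m in (p : Filter ℕ), ∀ᶠ n in (p : Filter ℕ), m + n ∈ s

omit [TopologicalSpace G] [IsTopologicalGroup G] in
-- Idempotence splits the limit over `m + n` into an iterated limit. Closed neighbourhoods are used
-- so that the inner limit over `n` stays inside.
theorem tendsto_pow_smul_limit {X : Type*} [TopologicalSpace X] [RegularSpace X]
    [MulAction G X] [ContinuousConstSMul G X] {p : Ultrafilter ℕ} (hp : IsIdempotentUltrafilter p)
    {g : G} {x y : X} (h : Tendsto (fun n : ℕ => g ^ n • x) p (𝓝 y)) :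
    Tendsto (fun n : ℕ => g ^ n • y) p (𝓝 y) := by
  rw [(closed_nhds_basis y).tendsto_right_iff]
  rintro C ⟨hC, hCc⟩
  filter_upwards [hp _ (h hC)] with m hm
  refine hCc.mem_of_tendsto (h.const_smul (g ^ m)) ?_
  filter_upwards [hm] with n hn
  have : g ^ (m + n) • x ∈ C := hn
  rwa [pow_add, mul_smul] at this

/-- Recurrence along an idempotent ultrafilter lifts from `G ⧸ H'` to `G ⧸ H` when `H'`
normalizes `H`. -/
theorem tendsto_pow_smul_of_normalizes {p : Ultrafilter ℕ} (hp : IsIdempotentUltrafilter p)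
    {H H' : Subgroup G} (hH : IsClosed (H : Set G)) (hH' : IsClosed (H' : Set G)) (hle : H ≤ H')
    (hnorm : ∀ h ∈ H', ∀ x ∈ H, h⁻¹ * x * h ∈ H) [CompactSpace (G ⧸ H)] (g : G)
    (hrec : ∀ x : G ⧸ H', Tendsto (fun n : ℕ => g ^ n • x) p (𝓝 x)) (x : G ⧸ H) :
    Tendsto (fun n : ℕ => g ^ n • x) p (𝓝 x) := by
  have := t2Space_quotient_of_isClosed hH
  have := t2Space_quotient_of_isClosed hH'
  obtain ⟨y, -, hy⟩ := isCompact_univ.ultrafilter_le_nhds (p.map fun n : ℕ => g ^ n • x) (by simp)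
  replace hy : Tendsto (fun n : ℕ => g ^ n • x) p (𝓝 y) := hy
  have hyy := tendsto_pow_smul_limit hp hy
  -- `x` and `y` have the same image in `G ⧸ H'`, so `y = R x` for a right translation `R` commuting
  -- with `g`. Then `g ^ n • y` tends both to `R y` and to `y`, so `R` fixes `y`, which forces `h ∈
  -- H`.
  suffices y = x by rwa [this] at hy
  obtain ⟨a, rfl⟩ := QuotientGroup.mk_surjective x
  obtain ⟨b, rfl⟩ := QuotientGroup.mk_surjective y
  have hpr : Continuous (fun z : G ⧸ H => Subgroup.quotientMapOfLE hle z) :=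
    Continuous.quotient_lift QuotientGroup.continuous_mk _
  have hlim : Tendsto (fun n : ℕ => g ^ n • (a : G ⧸ H')) p (𝓝 (b : G ⧸ H')) :=
    (hpr.tendsto _).comp hy
  have hab : (a : G ⧸ H') = b := tendsto_nhds_unique (hrec a) hlim
  have hh : a⁻¹ * b ∈ H' := QuotientGroup.eq.1 hab
  set h := a⁻¹ * b with hdef
  have hb : b = a * h := by simp [hdef]
  let R := quotientRightMul H h (hnorm h hh)
  have hR : Continuous R := continuous_quotientRightMul H h (hnorm h hh)
  have hRa : R (a : G ⧸ H) = b := by rw [hb]; rfl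
  have h1 : Tendsto (fun n : ℕ => g ^ n • (b : G ⧸ H)) p (𝓝 (R b)) := by
    have := (hR.tendsto _).comp hy
    refine this.congr fun n => ?_
    rw [← hRa]
    exact quotientRightMul_smul H h (hnorm h hh) (g ^ n) a
  have h2 : R (b : G ⧸ H) = b := tendsto_nhds_unique h1 hyy
  have h3 : ((b * h : G) : G ⧸ H) = b := h2
  rw [eq_comm, QuotientGroup.eq] at h3
  rw [eq_comm, QuotientGroup.eq]
  simpa using h3

/-- The closure of the product of `Γ` with a term of the upper central series. -/
def centralClosure (Γ : Subgroup G) (i : ℕ) : Subgroup G :=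
  (Subgroup.upperCentralSeries G i ⊔ Γ).topologicalClosure

theorem le_centralClosure (Γ : Subgroup G) (i : ℕ) : Γ ≤ centralClosure Γ i :=
  le_sup_right.trans (Subgroup.le_topologicalClosure _)

theorem isClosed_normalizer {H : Subgroup G} (hH : IsClosed (H : Set G)) :
    IsClosed (Subgroup.normalizer (H : Set G) : Set G) := by
  have : (Subgroup.normalizer (H : Set G) : Set G) =
      ⋂ x ∈ H, ((fun k : G => k * x * k⁻¹) ⁻¹' (H : Set G) ∩
        (fun k : G => k⁻¹ * x * k) ⁻¹' (H : Set G)) := by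
    ext k
    simp only [SetLike.mem_coe, Subgroup.mem_normalizer_iff, Set.mem_iInter, Set.mem_inter_iff,
      Set.mem_preimage]
    refine ⟨fun h x hx => ⟨(h x).1 hx, (h _).2 (by simpa [mul_assoc] using hx)⟩,
      fun h x => ⟨fun hx => (h x hx).1, fun hx => ?_⟩⟩
    simpa [mul_assoc] using (h _ hx).2
  rw [this]
  exact isClosed_biInter fun x _ =>
    (hH.preimage (by fun_prop)).inter (hH.preimage (by fun_prop))

/-- Conjugating `γ ∈ Γ` by an element of the `(i+1)`-st upper central term changes it by a
commutator in the `i`-th. Since that term is normal and `H` is closed, testing on `Γ` suffices;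
since the normalizer is closed, the conclusion passes to the closure. -/
theorem conj_mem_centralClosure (Γ : Subgroup G) (i : ℕ) {h x : G}
    (hh : h ∈ centralClosure Γ (i + 1)) (hx : x ∈ centralClosure Γ i) :
    h⁻¹ * x * h ∈ centralClosure Γ i := by
  set H := centralClosure Γ i with hHdef
  have hHc : IsClosed (H : Set G) := Subgroup.isClosed_topologicalClosure _
  have hZ : Subgroup.upperCentralSeries G i ≤ H :=
    le_sup_left.trans (Subgroup.le_topologicalClosure _)
  have hΓ : Γ ≤ H := le_centralClosure Γ i
  have hnormal : (Subgroup.upperCentralSeries G i).Normal := inferInstance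
  have hconj : ∀ k : G, (∀ γ ∈ Γ, k * γ * k⁻¹ ∈ H) → ∀ x ∈ H, k * x * k⁻¹ ∈ H := by
    intro k hk
    have hle : H ≤ H.comap (MulAut.conj k).toMonoidHom := by
      refine Subgroup.topologicalClosure_minimal _
        (sup_le (fun z hz => hZ (hnormal.conj_mem z hz k)) hk) (hHc.preimage ?_)
      exact (continuous_const.mul continuous_id).mul continuous_const
    exact fun x hx => hle hx
  have hnormalizer : ∀ K : Subgroup G, (∀ k ∈ K, ∀ γ ∈ Γ, k * γ * k⁻¹ ∈ H) →
      K ≤ Subgroup.normalizer (H : Set G) := by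
    intro K hK k hk
    rw [Subgroup.mem_normalizer_iff]
    refine fun x => ⟨hconj k (hK k hk) x, fun hx => ?_⟩
    simpa [mul_assoc] using hconj k⁻¹ (hK _ (inv_mem hk)) _ hx
  have key : centralClosure Γ (i + 1) ≤ Subgroup.normalizer (H : Set G) := by
    refine Subgroup.topologicalClosure_minimal _ (sup_le (hnormalizer _ ?_) (hnormalizer _ ?_))
      (isClosed_normalizer hHc)
    · intro z hz γ hγ
      have h1 := hZ (Subgroup.mem_upperCentralSeries_succ_iff.1 hz γ)
      have h2 := mul_mem h1 (hΓ hγ)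
      rwa [commutatorElement_def, inv_mul_cancel_right] at h2
    · exact fun k hk γ hγ => hΓ (mul_mem (mul_mem hk hγ) (inv_mem hk))
  have := (Subgroup.mem_normalizer_iff.1 (inv_mem (key hh)) x).1 hx
  simpa using this

theorem tendsto_pow_smul_of_idempotent [Group.IsNilpotent G] {p : Ultrafilter ℕ}
    (hp : IsIdempotentUltrafilter p) {Γ : Subgroup G} (hΓ : IsClosed (Γ : Set G))
    [CompactSpace (G ⧸ Γ)] (g : G) (x : G ⧸ Γ) :
    Tendsto (fun n : ℕ => g ^ n • x) p (𝓝 x) := by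
  have hcpt : ∀ i, CompactSpace (G ⧸ centralClosure Γ i) := fun i => by
    refine Function.Surjective.compactSpace
      (f := Subgroup.quotientMapOfLE (le_centralClosure Γ i))
      (Continuous.quotient_lift QuotientGroup.continuous_mk _) ?_
    intro y
    obtain ⟨a, rfl⟩ := QuotientGroup.mk_surjective y
    exact ⟨(a : G ⧸ Γ), rfl⟩
  have hcl : ∀ i, IsClosed (centralClosure Γ i : Set G) := fun i =>
    Subgroup.isClosed_topologicalClosure _
  obtain ⟨k, hk⟩ := Group.IsNilpotent.nilpotent G
  have htop : ∀ x : G ⧸ centralClosure Γ k, Tendsto (fun n : ℕ => g ^ n • x) p (𝓝 x) := by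
    have : centralClosure Γ k = ⊤ := by
      rw [eq_top_iff, ← hk]
      exact le_sup_left.trans (Subgroup.le_topologicalClosure _)
    have : Subsingleton (G ⧸ centralClosure Γ k) := by
      rw [this]; exact QuotientGroup.subsingleton_quotient_top
    intro x
    exact tendsto_const_nhds.congr fun n => Subsingleton.elim _ _
  have hzero : ∀ x : G ⧸ centralClosure Γ 0, Tendsto (fun n : ℕ => g ^ n • x) p (𝓝 x) := by
    refine Nat.decreasingInduction (n := k)
      (motive := fun i _ => ∀ x : G ⧸ centralClosure Γ i,
        Tendsto (fun n : ℕ => g ^ n • x) p (𝓝 x)) ?_ htop (Nat.zero_le k)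
    intro i _ ih x
    have := hcpt i
    refine tendsto_pow_smul_of_normalizes hp (hcl i) (hcl (i + 1)) ?_
      (fun h hh x hx => conj_mem_centralClosure Γ i hh hx) g ih x
    exact Subgroup.topologicalClosure_mono
      (sup_le_sup_right (Subgroup.upperCentralSeries_mono G (Nat.le_succ i)) Γ)
  -- The bottom of the tower is the closure of `Γ`, hence `Γ` itself; one more lift avoids
  -- transporting along this equality.
  refine tendsto_pow_smul_of_normalizes hp hΓ (hcl 0) (le_centralClosure Γ 0) ?_ g hzero x
  intro h hh x hx
  have : centralClosure Γ 0 ≤ Γ :=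
    Subgroup.topologicalClosure_minimal _ (by simp) hΓ
  exact mul_mem (mul_mem (inv_mem (this hh)) hx) (this hh)

end Nilpotent

/-! ### Idempotent ultrafilters and the density filter -/

attribute [local instance] Ultrafilter.add Ultrafilter.addSemigroup in
-- By `hL`, the ultrafilters refining `L` form a nonempty closed subsemigroup of `βℕ`, which
-- contains an idempotent by Ellis–Numakura.
theorem exists_idempotentUltrafilter_le {L : Filter ℕ} [L.NeBot]
    (hL : ∀ s ∈ L, ∀ᶠ m in L, ∀ᶠ n in L, m + n ∈ s) :
    ∃ p : Ultrafilter ℕ, (p : Filter ℕ) ≤ L ∧ IsIdempotentUltrafilter p := by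
  have hclosed : IsClosed {p : Ultrafilter ℕ | (p : Filter ℕ) ≤ L} := by
    have : {p : Ultrafilter ℕ | (p : Filter ℕ) ≤ L} = ⋂ s ∈ L, {p : Ultrafilter ℕ | s ∈ p} := by
      ext p
      simp [Filter.le_def]
    rw [this]
    exact isClosed_biInter fun s _ => ultrafilter_isClosed_basic s
  obtain ⟨p, hpL, hp⟩ := exists_idempotent_in_compact_add_subsemigroup
    (fun r : Ultrafilter ℕ => Ultrafilter.continuous_add_left r)
    {p : Ultrafilter ℕ | (p : Filter ℕ) ≤ L} ⟨Ultrafilter.of L, Ultrafilter.of_le L⟩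
    hclosed.isCompact (fun x hx y hy s hs => by
      refine (Ultrafilter.eventually_add x y (· ∈ s)).2 ?_
      exact ((hL s hs).filter_mono hx).mono fun m hm => hm.filter_mono hy)
  refine ⟨p, hpL, fun s hs => ?_⟩
  rw [← hp] at hs
  exact (Ultrafilter.eventually_add p p (· ∈ s)).1 hs

/-- `A` has natural density zero. -/
def HasDensityZero (A : Set ℕ) : Prop :=
  Tendsto (fun N : ℕ => (Set.ncard {n : ℕ | 1 ≤ n ∧ n ≤ N ∧ n ∈ A} : ℝ) / (N : ℝ)) atTop (𝓝 0)

theorem finite_setOf_between (A : Set ℕ) (N : ℕ) : {n : ℕ | 1 ≤ n ∧ n ≤ N ∧ n ∈ A}.Finite :=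
  (Set.finite_Icc 1 N).subset fun _ hn => ⟨hn.1, hn.2.1⟩

theorem HasDensityZero.mono {A B : Set ℕ} (hB : HasDensityZero B) (h : A ⊆ B) :
    HasDensityZero A := by
  refine squeeze_zero (fun N => by positivity) (fun N => ?_) hB
  gcongr
  exact finite_setOf_between B N

theorem HasDensityZero.union {A B : Set ℕ} (hA : HasDensityZero A) (hB : HasDensityZero B) :
    HasDensityZero (A ∪ B) := by
  have hsum := hA.add hB
  rw [add_zero] at hsum
  refine squeeze_zero (fun N => by positivity) (fun N => ?_) hsum
  rw [← add_div]
  gcongr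
  rw [← Nat.cast_add, Nat.cast_le]
  refine le_trans (Set.ncard_le_ncard ?_
    ((finite_setOf_between A N).union (finite_setOf_between B N))) (Set.ncard_union_le _ _)
  rintro n ⟨h1, h2, h3 | h3⟩
  exacts [Or.inl ⟨h1, h2, h3⟩, Or.inr ⟨h1, h2, h3⟩]

theorem HasDensityZero.of_finite {A : Set ℕ} (hA : A.Finite) : HasDensityZero A := by
  refine squeeze_zero (fun N => by positivity) (fun N => ?_)
    (tendsto_const_div_atTop_nhds_zero_nat (A.ncard : ℝ))
  gcongr
  exact fun n hn => hn.2.2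

theorem not_hasDensityZero_univ : ¬ HasDensityZero Set.univ := by
  intro h
  have h1 : Tendsto (fun _ : ℕ => (1 : ℝ)) atTop (𝓝 0) := by
    refine h.congr' ?_
    filter_upwards [eventually_ge_atTop 1] with N hN
    have : {n : ℕ | 1 ≤ n ∧ n ≤ N ∧ n ∈ Set.univ} = (Finset.Icc 1 N : Finset ℕ) := by
      ext n
      simp
    rw [this, Set.ncard_coe_finset, Nat.card_Icc, Nat.add_sub_cancel]
    exact div_self (by positivity)
  exact one_ne_zero (tendsto_nhds_unique tendsto_const_nhds h1)

theorem HasDensityZero.preimage_add {A : Set ℕ} (hA : HasDensityZero A) (m : ℕ) :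
    HasDensityZero {n | m + n ∈ A} := by
  have h1 : Tendsto (fun N : ℕ => ((m + N : ℕ) : ℝ) / (N : ℝ)) atTop (𝓝 (0 + 1)) := by
    refine ((tendsto_const_div_atTop_nhds_zero_nat (m : ℝ)).add_const 1).congr' ?_
    filter_upwards [eventually_ge_atTop 1] with N hN
    have : (N : ℝ) ≠ 0 := by positivity
    push_cast
    field_simp
  have h2 := (hA.comp (tendsto_add_atTop_nat m)).mul h1
  rw [zero_mul] at h2
  refine squeeze_zero' (.of_forall fun N => by positivity) ?_ h2
  filter_upwards [eventually_ge_atTop 1] with N hN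
  have h0 : (N : ℝ) ≠ 0 := by positivity
  have h3 : ((m + N : ℕ) : ℝ) ≠ 0 := by positivity
  rw [Function.comp_apply, add_comm N m, div_mul_div_cancel₀ h3]
  refine div_le_div_of_nonneg_right (Nat.cast_le.2 ?_) (Nat.cast_nonneg N)
  refine Set.ncard_le_ncard_of_injOn (m + ·) ?_ (fun a _ b _ h => Nat.add_left_cancel h)
    (finite_setOf_between A _)
  rintro n ⟨hn1, hn2, hn3⟩
  exact ⟨by omega, by omega, hn3⟩

/-- The filter of sets of natural numbers whose complement has natural density zero. -/
def densityFilter : Filter ℕ where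
  sets := {s | HasDensityZero sᶜ}
  univ_sets := by
    simpa using HasDensityZero.of_finite Set.finite_empty
  sets_of_superset hs hst := HasDensityZero.mono hs (Set.compl_subset_compl.2 hst)
  inter_sets hs ht := by
    simpa only [Set.mem_ofPred_eq, Set.compl_inter] using HasDensityZero.union hs ht

theorem mem_densityFilter {s : Set ℕ} : s ∈ densityFilter ↔ HasDensityZero sᶜ := Iff.rfl

theorem tendsto_add_densityFilter (m : ℕ) :
    Tendsto (fun n => m + n) densityFilter densityFilter :=
  fun _ hs => HasDensityZero.preimage_add hs m

/-! ### Rotations of the circle -/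

/-- Times, up to sets of density zero, at which `c n` is close to, and above, an integer. -/
noncomputable def returnFilter (c : ℝ) : Filter ℕ :=
  densityFilter ⊓ comap (fun n : ℕ => Int.fract (c * n)) (𝓝[>] 0)

/-- Density of the orbit makes preimages of the arc under multiples of the rotation cover the
circle; compactness leaves finitely many, and `L` bounds their indices. -/
theorem exists_add_fract_mem_Ioo {c δ : ℝ} (hc : Irrational c) (hδ : 0 < δ) :
    ∃ L : ℕ, ∀ n : ℕ, ∃ j < L, Int.fract (c * (j + n : ℕ)) ∈ Set.Ioo 0 δ := by
  have hdense : DenseRange (fun n : ℕ => n • (c : UnitAddCircle)) :=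
    denseRange_zsmul_iff_nsmul.1 (AddCircle.denseRange_zsmul_coe_iff.2 (by simpa using hc))
  set V : Set UnitAddCircle := (fun x : ℝ => (x : UnitAddCircle)) '' Set.Ioo 0 (min δ 1) with hV
  have hVo : IsOpen V := QuotientAddGroup.isOpenMap_coe _ isOpen_Ioo
  have hVn : V.Nonempty := (Set.nonempty_Ioo.2 (lt_min hδ one_pos)).image _
  have hcover : ∀ x : UnitAddCircle, ∃ j : ℕ, j • (c : UnitAddCircle) + x ∈ V := by
    intro x
    obtain ⟨j, hj⟩ := hdense.exists_mem_open
      (hVo.preimage (continuous_add_const x)) (by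
        obtain ⟨v, hv⟩ := hVn
        exact ⟨v - x, by simpa using hv⟩)
    exact ⟨j, hj⟩
  obtain ⟨t, ht⟩ := isCompact_univ.elim_finite_subcover
    (fun j : ℕ => (fun x => j • (c : UnitAddCircle) + x) ⁻¹' V)
    (fun j => hVo.preimage (continuous_const_add _))
    (fun x _ => Set.mem_iUnion.2 (hcover x))
  obtain ⟨L, hL⟩ := t.exists_nat_subset_range
  refine ⟨L, fun n => ?_⟩
  have := ht (Set.mem_univ (n • (c : UnitAddCircle)))
  simp only [Set.mem_iUnion, Set.mem_preimage, exists_prop] at this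
  obtain ⟨j, hj, x, hx, hxe⟩ := this
  refine ⟨j, Finset.mem_range.1 (hL hj), ?_⟩
  have heq : ((x - c * (j + n : ℕ) : ℝ) : UnitAddCircle) = 0 := by
    have hxe' : (x : UnitAddCircle) = j • (c : UnitAddCircle) + n • (c : UnitAddCircle) := hxe
    rw [AddCircle.coe_sub, sub_eq_zero, hxe', ← add_nsmul, ← AddCircle.coe_nsmul, nsmul_eq_mul,
      mul_comm]
  obtain ⟨z, hz⟩ := (AddCircle.coe_eq_zero_iff 1).1 heq
  have hfract : Int.fract (c * (j + n : ℕ)) = x := by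
    rw [Int.fract_eq_iff]
    refine ⟨hx.1.le, hx.2.trans_le (min_le_right _ _), -z, ?_⟩
    rw [zsmul_eq_mul, mul_one] at hz
    push_cast at hz ⊢
    linarith
  rw [hfract]
  exact ⟨hx.1, hx.2.trans_le (min_le_left _ _)⟩

theorem returnFilter_neBot {c : ℝ} (hc : Irrational c) : (returnFilter c).NeBot := by
  rw [returnFilter, inf_neBot_iff]
  intro s hs t ht
  obtain ⟨u, hu, hut⟩ := mem_comap.1 ht
  obtain ⟨δ, hδ, hδu⟩ := mem_nhdsGT_iff_exists_Ioo_subset.1 hu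
  obtain ⟨L, hL⟩ := exists_add_fract_mem_Ioo hc hδ
  -- Otherwise the return times `t` have density zero, and so does the union of their first `L`
  -- shifts, which is all of `ℕ`.
  by_contra hemp
  have ht0 : HasDensityZero t := HasDensityZero.mono hs fun n hn hns => hemp ⟨n, hns, hn⟩
  have hunion : ∀ K : ℕ, HasDensityZero {n | ∃ j < K, j + n ∈ t} := by
    intro K
    induction K with
    | zero => simpa using HasDensityZero.of_finite Set.finite_empty
    | succ K ih =>
      refine (ih.union (ht0.preimage_add K)).mono ?_
      rintro n ⟨j, hj, hjn⟩
      rcases Nat.lt_succ_iff_lt_or_eq.1 hj with h | rfl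
      exacts [Or.inl ⟨j, h, hjn⟩, Or.inr hjn]
  refine not_hasDensityZero_univ ((hunion L).mono fun n _ => ?_)
  obtain ⟨j, hj, hjn⟩ := hL n
  exact ⟨j, hj, hut (hδu hjn)⟩

theorem fract_add_mem_Ioo {a b δ : ℝ} (hδ : δ ≤ 1) (ha : Int.fract a ∈ Set.Ioo 0 (δ / 2))
    (hb : Int.fract b ∈ Set.Ioo 0 (δ / 2)) : Int.fract (a + b) ∈ Set.Ioo 0 δ := by
  have : Int.fract (a + b) = Int.fract a + Int.fract b := by
    rw [Int.fract_eq_iff]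
    refine ⟨by linarith [ha.1, hb.1], by linarith [ha.2, hb.2], ⌊a⌋ + ⌊b⌋, ?_⟩
    push_cast
    linarith [Int.fract_add_floor a, Int.fract_add_floor b]
  rw [this]
  exact ⟨by linarith [ha.1, hb.1], by linarith [ha.2, hb.2]⟩

theorem fract_mem_Ioo_mem_returnFilter (c : ℝ) {δ : ℝ} (hδ : 0 < δ) :
    ∀ᶠ n : ℕ in returnFilter c, Int.fract (c * n) ∈ Set.Ioo 0 δ :=
  mem_inf_of_right (preimage_mem_comap (Ioo_mem_nhdsGT hδ))

/-- Small positive fractional parts add without carry, so approach to `0` from the right survives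
addition of times. -/
theorem returnFilter_add (c : ℝ) : ∀ s ∈ returnFilter c,
    ∀ᶠ m in returnFilter c, ∀ᶠ n in returnFilter c, m + n ∈ s := by
  intro s hs
  obtain ⟨s₁, hs₁, t, ht, rfl⟩ := mem_inf_iff.1 hs
  obtain ⟨u, hu, hut⟩ := mem_comap.1 ht
  obtain ⟨δ, hδ, hδu⟩ := mem_nhdsGT_iff_exists_Ioo_subset.1 hu
  have hδ0 : 0 < min δ 1 / 2 := half_pos (lt_min hδ one_pos)
  filter_upwards [fract_mem_Ioo_mem_returnFilter c hδ0] with m hm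
  filter_upwards [fract_mem_Ioo_mem_returnFilter c hδ0,
    mem_inf_of_left (tendsto_add_densityFilter m hs₁)] with n hn hn'
  refine ⟨hn', hut (hδu ?_)⟩
  have := fract_add_mem_Ioo (min_le_right δ 1) hm hn
  rw [← mul_add, ← Nat.cast_add] at this
  exact ⟨this.1, this.2.trans_le (min_le_left _ _)⟩

theorem exists_idempotentUltrafilter_returnFilter {c : ℝ} (hc : Irrational c) :
    ∃ p : Ultrafilter ℕ, IsIdempotentUltrafilter p ∧ (p : Filter ℕ) ≤ densityFilter ∧
      Tendsto (fun n : ℕ => Int.fract (c * n)) p (𝓝[>] 0) := by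
  have := returnFilter_neBot hc
  obtain ⟨p, hpL, hp⟩ := exists_idempotentUltrafilter_le (returnFilter_add c)
  exact ⟨p, hp, hpL.trans inf_le_left, tendsto_iff_comap.2 (hpL.trans inf_le_right)⟩

/-! ### Nilsequences along idempotent ultrafilters -/

theorem IsKStepNilsequence.exists_tendsto {k : ℕ} {ψ : ℕ → ℂ} (hψ : IsKStepNilsequence.{u} k ψ) :
    ∃ z : ℂ, ∀ p : Ultrafilter ℕ, IsIdempotentUltrafilter p → Tendsto ψ p (𝓝 z) := by
  obtain ⟨D, G, _, _, _, hLie, _, _, -, Γ, _, _, F, g, x, hF, hψF⟩ := hψ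
  have : IsTopologicalGroup G := topologicalGroup_of_lieGroup (𝓡 D) ∞
  have hΓ : IsClosed (Γ : Set G) := Subgroup.isClosed_of_discrete
  refine ⟨F x, fun p hp => ?_⟩
  exact ((hF.tendsto x).comp (tendsto_pow_smul_of_idempotent hp hΓ g x)).congr
    fun n => (hψF n).symm

/-- A sequence which agrees, up to arbitrarily small errors off sets of density zero, with a
uniform limit of nilsequences has the same limit along all idempotent ultrafilters that refine the
density filter. -/
theorem IsUniformLimitOfNilsequences.limits_eq {α φ : ℕ → ℂ}
    (hφ : IsUniformLimitOfNilsequences.{u} φ)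
    (hα : ∀ ε : ℝ, 0 < ε → HasDensityZero {n | ε ≤ ‖α n - φ n‖})
    {p q : Ultrafilter ℕ} (hp : IsIdempotentUltrafilter p) (hq : IsIdempotentUltrafilter q)
    (hpd : (p : Filter ℕ) ≤ densityFilter) (hqd : (q : Filter ℕ) ≤ densityFilter)
    {a b : ℂ} (ha : Tendsto α p (𝓝 a)) (hb : Tendsto α q (𝓝 b)) : a = b := by
  rw [← sub_eq_zero, ← norm_le_zero_iff]
  refine le_of_forall_pos_le_add fun ε hε => ?_
  have hε4 : 0 < ε / 4 := by positivity
  obtain ⟨k, ψ, hψ, hφψ⟩ := hφ (ε / 4) hε4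
  obtain ⟨z, hz⟩ := hψ.exists_tendsto
  have hclose : ∀ᶠ n in densityFilter, ‖α n - ψ n‖ ≤ ε / 2 := by
    -- The approximation by `ψ` is available only for `n ≥ 1`.
    have h0 : ∀ᶠ n in densityFilter, 1 ≤ n :=
      HasDensityZero.mono (HasDensityZero.of_finite (Set.finite_singleton 0)) fun n hn => by
        simpa using hn
    have h1 : ∀ᶠ n in densityFilter, ‖α n - φ n‖ < ε / 4 :=
      HasDensityZero.mono (hα _ hε4) fun n hn => by simpa using hn
    filter_upwards [h0, h1] with n hn hn1
    have := norm_sub_le_norm_sub_add_norm_sub (α n) (φ n) (ψ n)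
    linarith [hφψ n hn]
  have haz : ‖a - z‖ ≤ ε / 2 := le_of_tendsto (ha.sub (hz p hp)).norm (hpd hclose)
  have hbz : ‖b - z‖ ≤ ε / 2 := le_of_tendsto (hb.sub (hz q hq)).norm (hqd hclose)
  have := norm_sub_le_norm_sub_add_norm_sub a z b
  rw [norm_sub_rev z b] at this
  linarith

/-- Markov's inequality for the counting measure on `{1, …, N}`. -/
theorem CesaroAgree.hasDensityZero {α φ : ℕ → ℂ} (h : CesaroAgree α φ) {ε : ℝ} (hε : 0 < ε) :
    HasDensityZero {n | ε ≤ ‖α n - φ n‖} := by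
  have h1 := Tendsto.const_mul ε⁻¹ h
  rw [mul_zero] at h1
  refine squeeze_zero (fun N => by positivity) (fun N => ?_) h1
  rw [← mul_div_assoc]
  gcongr
  rw [← div_eq_inv_mul, le_div_iff₀ hε]
  have hset : {n : ℕ | 1 ≤ n ∧ n ≤ N ∧ n ∈ {n | ε ≤ ‖α n - φ n‖}} =
      ((Finset.Icc 1 N).filter fun n => ε ≤ ‖α n - φ n‖ : Finset ℕ) := by
    ext n
    simp [and_assoc]
  rw [hset, Set.ncard_coe_finset, ← nsmul_eq_mul]
  refine (Finset.card_nsmul_le_sum _ (fun n => ‖α n - φ n‖) ε fun n hn =>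
    (Finset.mem_filter.1 hn).2).trans ?_
  exact Finset.sum_le_sum_of_subset_of_nonneg (Finset.filter_subset _ _)
    fun _ _ _ => norm_nonneg _

theorem EqualOffDensityZero.hasDensityZero {α φ : ℕ → ℂ} (h : EqualOffDensityZero α φ) {ε : ℝ}
    (hε : 0 < ε) : HasDensityZero {n | ε ≤ ‖α n - φ n‖} := by
  refine HasDensityZero.mono (B := {n | α n ≠ φ n}) h fun n hn heq => ?_
  have hn' : ε ≤ ‖α n - φ n‖ := hn
  rw [heq, sub_self, norm_zero] at hn'
  linarith

theorem UniformCesaroAgree.cesaroAgree {α φ : ℕ → ℂ} (h : UniformCesaroAgree α φ) :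
    CesaroAgree α φ := by
  rw [CesaroAgree, Metric.tendsto_atTop]
  intro ε hε
  obtain ⟨L, hL⟩ := h (ε / 2) (half_pos hε)
  refine ⟨L, fun N hN => ?_⟩
  have h1 := hL 1 (N + 1) le_rfl (by omega)
  have h2 : Finset.Ico 1 (N + 1) = Finset.Icc 1 N := by
    ext n
    simp
  rw [h2, Nat.cast_add, Nat.cast_one, add_sub_cancel_right] at h1
  rw [Real.dist_0_eq_abs, abs_of_nonneg (by positivity)]
  linarith

theorem IsUniformLimitOfKStepNilsequences.isUniformLimitOfNilsequences {k : ℕ} {φ : ℕ → ℂ}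
    (h : IsUniformLimitOfKStepNilsequences.{u} k φ) : IsUniformLimitOfNilsequences.{u} φ :=
  fun ε hε => ⟨k, h ε hε⟩

/-! ### The example -/

theorem circleExp_coe (x : ℝ) :
    circleExp (x : UnitAddCircle) = Complex.exp (2 * Real.pi * Complex.I * (x : ℂ)) := by
  rw [circleExp, AddCircle.toCircle_apply_mk, Circle.coe_exp]
  congr 1
  push_cast
  ring

theorem continuous_circleExp : Continuous circleExp :=
  continuous_subtype_val.comp AddCircle.continuous_toCircle

theorem norm_circleExp (x : UnitAddCircle) : ‖circleExp x‖ = 1 := Circle.norm_coe _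

theorem circleExp_add (x y : UnitAddCircle) :
    circleExp (x + y) = circleExp x * circleExp y := by
  rw [circleExp, AddCircle.toCircle_add, Circle.coe_mul]
  rfl

/-- Makes the integrand defining `exampleAlpha` constant in `x`. -/
theorem circleExp_mul_neg_add (x y : UnitAddCircle) :
    circleExp x * circleExp (-(x + y)) = circleExp (-y) := by
  rw [← circleExp_add]
  congr 1
  abel

theorem rotationT_zpow_apply (z : ℤ) (x : UnitAddCircle) :
    (rotationT ^ z) x = x + ((z * (1 / Real.sqrt 2) : ℝ) : UnitAddCircle) := by
  have h (z : ℤ) : ((z * (1 / Real.sqrt 2) : ℝ) : UnitAddCircle) =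
      z • ((1 / Real.sqrt 2 : ℝ) : UnitAddCircle) := by
    rw [← AddCircle.coe_zsmul, zsmul_eq_mul]
  rw [h]
  induction z generalizing x with
  | zero => simp
  | succ n ih =>
    rw [zpow_add_one, Equiv.Perm.mul_apply, ih, add_zsmul, one_zsmul, rotationT,
      Equiv.coe_addRight, add_assoc, add_comm (_ • _)]
  | pred n ih =>
    rw [zpow_sub_one, Equiv.Perm.mul_apply, ih, sub_zsmul, one_zsmul, rotationT,
      Equiv.Perm.inv_def, Equiv.addRight_symm, Equiv.coe_addRight,
      add_assoc, add_comm (-_)]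

theorem isProbabilityMeasure_unitAddCircle :
    IsProbabilityMeasure (volume : Measure UnitAddCircle) :=
  ⟨UnitAddCircle.measure_univ⟩

theorem exampleAlpha_eq (n : ℕ) : exampleAlpha n =
    Complex.exp (2 * Real.pi * Complex.I *
      ((Int.fract (Real.sqrt 2 * (n : ℝ)) / Real.sqrt 2 : ℝ) : ℂ)) := by
  have hs : Real.sqrt 2 ≠ 0 := by positivity
  have := isProbabilityMeasure_unitAddCircle
  simp only [exampleAlpha, rotationT_zpow_apply, circleExp_mul_neg_add, integral_const,
    probReal_univ, one_smul]
  rw [← circleExp_coe, ← AddCircle.coe_neg]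
  congr 1
  rw [← sub_eq_zero, ← AddCircle.coe_sub, AddCircle.coe_eq_zero_iff]
  -- `-⌊√2 n⌋/√2 = -n + {√2 n}/√2`, so the two phases differ by the integer `-n`.
  refine ⟨-n, ?_⟩
  rw [zsmul_eq_mul]
  push_cast
  field_simp
  linarith [Int.floor_add_fract (n * Real.sqrt 2)]

theorem isMeasurePreservingAction_rotationT :
    IsMeasurePreservingAction (volume : Measure UnitAddCircle)
      (fun (v : Fin 1 → ℤ) x => (rotationT ^ v 0) x) where
  zero_act x := by simp
  add_act v w x := by simp [zpow_add]
  measurePreserving v := by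
    simp only [rotationT_zpow_apply]
    exact measurePreserving_add_right volume _

theorem memLp_top_of_norm_eq_one {X : Type*} [MeasurableSpace X] {μ : Measure X} {f : X → ℂ}
    (hf : AEStronglyMeasurable f μ) (h : ∀ x, ‖f x‖ = 1) : MemLp f ⊤ μ :=
  memLp_top_of_bound hf 1 (.of_forall fun x => (h x).le)

theorem isMulticorrelationSequence_exampleAlpha :
    IsMulticorrelationSequence 1 1 1 exampleAlpha := by
  refine ⟨UnitAddCircle, inferInstance, volume, fun v x => (rotationT ^ v 0) x,
    fun _ _ => Polynomial.C (Real.sqrt 2) * Polynomial.X, circleExp, fun _ x => circleExp (-x),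
    isProbabilityMeasure_unitAddCircle, isMeasurePreservingAction_rotationT,
    fun _ _ => (Polynomial.natDegree_C_mul_le _ _).trans Polynomial.natDegree_X_le,
    memLp_top_of_norm_eq_one continuous_circleExp.aestronglyMeasurable norm_circleExp,
    fun _ => memLp_top_of_norm_eq_one
      (continuous_circleExp.comp continuous_neg).aestronglyMeasurable fun x => norm_circleExp _,
    fun n => ?_⟩
  simp [exampleAlpha]

theorem tendsto_exampleAlpha {p : Filter ℕ} {t : ℝ}
    (h : Tendsto (fun n : ℕ => Int.fract (Real.sqrt 2 * n)) p (𝓝 t)) :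
    Tendsto exampleAlpha p
      (𝓝 (Complex.exp (2 * Real.pi * Complex.I * ((t / Real.sqrt 2 : ℝ) : ℂ)))) := by
  have hc : Continuous fun t : ℝ =>
      Complex.exp (2 * Real.pi * Complex.I * ((t / Real.sqrt 2 : ℝ) : ℂ)) := by fun_prop
  exact ((hc.tendsto t).comp h).congr fun n => (exampleAlpha_eq n).symm

theorem not_forall_hasDensityZero_exampleAlpha {φ : ℕ → ℂ}
    (hφ : IsUniformLimitOfNilsequences.{u} φ) :
    ¬ ∀ ε : ℝ, 0 < ε → HasDensityZero {n | ε ≤ ‖exampleAlpha n - φ n‖} := by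
  intro hα
  obtain ⟨p, hp, hpd, hp0⟩ := exists_idempotentUltrafilter_returnFilter irrational_sqrt_two
  -- Rotating by `-√2` turns right-hand returns to `0` into `{√2 n} → 1⁻`.
  obtain ⟨q, hq, hqd, hq0⟩ := exists_idempotentUltrafilter_returnFilter irrational_sqrt_two.neg
  have hq1 : Tendsto (fun n : ℕ => Int.fract (Real.sqrt 2 * n)) q (𝓝 1) := by
    have h1 : Tendsto (fun n : ℕ => 1 - Int.fract (-Real.sqrt 2 * n)) q (𝓝 (1 - 0)) :=
      (hq0.mono_right nhdsWithin_le_nhds).const_sub 1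
    rw [sub_zero] at h1
    refine h1.congr' ?_
    filter_upwards [hq0.eventually self_mem_nhdsWithin] with n hn
    rw [← Int.fract_neg (ne_of_gt hn), neg_mul, neg_neg]
  have heq := hφ.limits_eq hα hp hq hpd hqd
    (tendsto_exampleAlpha (hp0.mono_right nhdsWithin_le_nhds)) (tendsto_exampleAlpha hq1)
  -- Equality of the two limits would make `1/√2` an integer.
  rw [zero_div, Complex.ofReal_zero, mul_zero, Complex.exp_zero, eq_comm,
    Complex.exp_eq_one_iff] at heq
  obtain ⟨z, hz⟩ := heq
  rw [mul_comm (z : ℂ)] at hz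
  have hz' := mul_left_cancel₀ Complex.two_pi_I_ne_zero hz
  have hz'' : 1 / Real.sqrt 2 = (z : ℝ) := by exact_mod_cast hz'
  refine irrational_sqrt_two.inv.ne_int z ?_
  rw [← hz'', one_div]

theorem mainTheorem3 :
    -- `α` is a multicorrelation sequence with `ℓ = m = d = 1`
    IsMulticorrelationSequence 1 1 1 exampleAlpha ∧
    -- `α(n) = e({√2 n} / √2)`
    (∀ n : ℕ, exampleAlpha n =
      Complex.exp (2 * Real.pi * Complex.I *
        ((Int.fract (Real.sqrt 2 * (n : ℝ)) / Real.sqrt 2 : ℝ) : ℂ))) ∧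
    -- `α` does not agree with any uniform limit of nilsequences
    (∀ φ : ℕ → ℂ, IsUniformLimitOfNilsequences.{u} φ →
      ¬ CesaroAgree exampleAlpha φ ∧ ¬ EqualOffDensityZero exampleAlpha φ) ∧
    -- hence the error in the approximation theorem cannot be taken to be zero
    (∀ k : ℕ, ¬ ZeroErrorApproximation.{u} 1 1 1 k) := by
  refine ⟨isMulticorrelationSequence_exampleAlpha, exampleAlpha_eq, fun φ hφ =>
    ⟨fun h => not_forall_hasDensityZero_exampleAlpha hφ fun _ => h.hasDensityZero,
      fun h => not_forall_hasDensityZero_exampleAlpha hφ fun _ => h.hasDensityZero⟩, ?_⟩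
  intro k hk
  obtain ⟨φ, hφ, hunif, -⟩ := hk exampleAlpha isMulticorrelationSequence_exampleAlpha 1 0 le_rfl
  exact not_forall_hasDensityZero_exampleAlpha hφ.isUniformLimitOfNilsequences
    fun _ => hunif.cesaroAgree.hasDensityZero
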